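/- For $e\in\mathbb{N}_0$ let $k_e$ be the largest natural number with $\binom{k_e}{2}\le e$, and let $t_e=e-\binom{k_e}{2}$. For $n\ge 1$ let $\mathcal{C}_{n,e}$ be the set of connected simple graphs with $n$ vertices and $n-1+e$ edges (considered up to isomorphism). For $n\ge e+2$ let $$\mathcal{V}_{n,e}=\bigl(K_{1,e}+(n-e-2)K_1\bigr)\lor K_1\in\mathcal{C}_{n,e},$$ where $+$ denotes the disjoint union and $\lor$ the join of graphs. The spectral radius of a graph is the largest modulus of an eigenvalue of its adjacency matrix. Theorem. Let $e\ge 5$ be such that $t_e\ge 1$, and let $\ell_e=\dfrac{e\,k_e}{e-k_e-1}$. Then for every integer $$n>e+2+\frac{\ell_e(\ell_e+1)(\ell_e^2-\ell_e-2e)}{\ell_e^2-e}$$ (the right-hand side is well defined and larger than $e+2$), the graph $\mathcal{V}_{n,e}$ attains the maximum spectral radius on $\mathcal{C}_{n,e}$, and every graph in $\mathcal{C}_{n,e}$ attaining this maximum is isomorphic to $\mathcal{V}_{n,e}$. -/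

import Mathlib

/-- `cliqueParam e` is the largest natural number `k` with `k.choose 2 ≤ e`. The search bound `e + 1`
is no restriction, see `isGreatest_cliqueParam`. -/
def cliqueParam (e : ℕ) : ℕ := Nat.findGreatest (fun k => k.choose 2 ≤ e) (e + 1)

theorem isGreatest_cliqueParam (e : ℕ) : IsGreatest {k : ℕ | k.choose 2 ≤ e} (cliqueParam e) := by
  constructor
  · exact Nat.findGreatest_spec (P := fun k => k.choose 2 ≤ e) (Nat.zero_le _) (by simp)
  · intro k hk
    refine Nat.le_findGreatest ?_ hk
    by_contra hlt
    have h1 : (e + 2).choose 2 ≤ k.choose 2 := Nat.choose_le_choose 2 (by omega)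
    have h2 : (e + 2).choose 2 = (e + 1).choose 1 + (e + 1).choose 2 := Nat.choose_succ_succ _ _
    have h3 : k.choose 2 ≤ e := hk
    rw [Nat.choose_one_right] at h2
    omega

/-- `excessParam e = e - (cliqueParam e).choose 2`; no truncation occurs in this subtraction. -/
def excessParam (e : ℕ) : ℕ := e - (cliqueParam e).choose 2

/-- The real number `e * k / (e - k - 1)`, where `k = cliqueParam e`. -/
noncomputable def ellParam (e : ℕ) : ℝ :=
  (e : ℝ) * (cliqueParam e : ℝ) / ((e : ℝ) - (cliqueParam e : ℝ) - 1)

/-- The join of two graphs: their disjoint union together with all edges between them. -/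
def graphJoin {V W : Type*} (G : SimpleGraph V) (H : SimpleGraph W) : SimpleGraph (V ⊕ W) :=
  SimpleGraph.sum G H ⊔ completeBipartiteGraph V W

/-- The graph `(K_{1,e} + (n - e - 2) K_1) ∨ K_1`, of order `n` when `n ≥ e + 2`. -/
def graphV (n e : ℕ) : SimpleGraph (((Fin 1 ⊕ Fin e) ⊕ Fin (n - e - 2)) ⊕ Fin 1) :=
  graphJoin
    (SimpleGraph.sum (completeBipartiteGraph (Fin 1) (Fin e)) (⊥ : SimpleGraph (Fin (n - e - 2))))
    (⊤ : SimpleGraph (Fin 1))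

open Classical in
/-- The spectral radius of a finite graph: the supremum of the moduli of the complex eigenvalues of
its adjacency matrix (a maximum over a finite set when the graph has a vertex). -/
noncomputable def graphSpectralRadius {V : Type*} [Fintype V] (G : SimpleGraph V) : ENNReal :=
  spectralRadius ℂ (G.adjMatrix ℂ)

/-- `G` is a connected graph with `n` vertices and `n - 1 + e` edges. -/
def InClassC (n e : ℕ) {V : Type*} [Fintype V] (G : SimpleGraph V) : Prop :=
  G.Connected ∧ Fintype.card V = n ∧ G.edgeSet.ncard + 1 = n + e

/-- `G` is a connected graph with `n` vertices and `n - 1 + e` edges whose spectral radius is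
maximum among all such graphs (each of which is isomorphic to one with vertex set `Fin n`). -/
def AttainsMaxSpectralRadius (n e : ℕ) {V : Type*} [Fintype V] (G : SimpleGraph V) : Prop :=
  InClassC n e G ∧
    ∀ H : SimpleGraph (Fin n), InClassC n e H → graphSpectralRadius H ≤ graphSpectralRadius G

open Matrix

/-! Let G be extremal, with spectral radius l and Perron vector x. Rotating edges towards larger
entries of x shows that the vertex u of largest entry is dominating. With v the vertex of second
largest entry and N the neighbours of v other than u, it also puts both ends of every edge avoiding
u and v into N. So G is given by the d = |N| ≤ e vertices of N and the e - d edges among them, and d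
= e is the graph V of the theorem.

Eliminating every entry but x_u from the eigenvalue equations leaves l = `coneWeight (n - 2) d (d +
T) l`, where T is the degree-weighted sum over N of the solution of (l - A_N) z = 1.
`degree_weighted_sum_le` bounds T, sharply when N induces a clique. If d < e, `coneWeight_lt` then
gives l < `coneWeight (n - 2) e e l`, so a test vector on V has Rayleigh quotient above l
(`lt_graphSpectralRadius_graphV`), against extremality.

This comparison needs q² < l(q - 2), where q(q + 1) = 2e. The bound on n says exactly that `ellParam
e` < `coneWeight (n - 2) e e (ellParam e)`; hence l ≥ ρ(V) > `ellParam e`, and `ellParam e` exceeds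
q²/(q - 2). -/

open Classical in
/-- The real adjacency matrix. -/
noncomputable def adjR {V : Type*} (G : SimpleGraph V) : Matrix V V ℝ :=
  Matrix.of fun i j => if G.Adj i j then 1 else 0

/-! ### Perron theory for the adjacency matrix -/

section Perron
variable {V : Type*} (G : SimpleGraph V)

theorem adjR_of_adj {i j : V} (h : G.Adj i j) : adjR G i j = 1 := by simp [adjR, h]

theorem adjR_of_not_adj {i j : V} (h : ¬ G.Adj i j) : adjR G i j = 0 := by simp [adjR, h]

theorem adjR_nonneg (i j : V) : 0 ≤ adjR G i j := by
  by_cases h : G.Adj i j <;> simp [adjR, h]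

theorem adjR_congr {W : Type*} {G : SimpleGraph V} {H : SimpleGraph W} {i j : V} {k l : W}
    (h : G.Adj i j ↔ H.Adj k l) : adjR G i j = adjR H k l := by
  by_cases hG : G.Adj i j
  · rw [adjR_of_adj G hG, adjR_of_adj H (h.mp hG)]
  · rw [adjR_of_not_adj G hG, adjR_of_not_adj H (mt h.mpr hG)]

theorem adjR_comm (i j : V) : adjR G i j = adjR G j i :=
  adjR_congr (G.adj_comm i j)

variable [Fintype V]

theorem dotProduct_adjR_mulVec_le_abs (x : V → ℝ) :
    x ⬝ᵥ adjR G *ᵥ x ≤ (fun i => |x i|) ⬝ᵥ adjR G *ᵥ (fun i => |x i|) := by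
  simp only [dotProduct, mulVec, Finset.mul_sum]
  refine Finset.sum_le_sum fun i _ => Finset.sum_le_sum fun j _ => ?_
  calc x i * (adjR G i j * x j) ≤ |x i * (adjR G i j * x j)| := le_abs_self _
    _ = _ := by rw [abs_mul, abs_mul, abs_of_nonneg (adjR_nonneg G i j)]

/-- Entrywise absolute values keep a unit maximiser of the quadratic form maximal, as the matrix is
nonnegative. A zero of a positive semidefinite form lies in its kernel, so the maximiser is an
eigenvector. -/
theorem exists_rayleigh_max [Nonempty V] [DecidableEq V] :
    ∃ r : ℝ, (r • (1 : Matrix V V ℝ) - adjR G).PosSemidef ∧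
      ∃ x : V → ℝ, (∀ i, 0 ≤ x i) ∧ x ≠ 0 ∧ adjR G *ᵥ x = r • x := by
  have hcpt : IsCompact {x : V → ℝ | x ⬝ᵥ x = 1} := by
    refine Metric.isCompact_of_isClosed_isBounded ?_ ?_
    · exact isClosed_eq (by unfold dotProduct; fun_prop) continuous_const
    · refine (Metric.isBounded_closedBall (x := (0 : V → ℝ)) (r := 1)).subset fun x hx => ?_
      rw [mem_closedBall_zero_iff, pi_norm_le_iff_of_nonneg zero_le_one]
      intro i
      have h1 : x i * x i ≤ x ⬝ᵥ x :=
        Finset.single_le_sum (f := fun i => x i * x i) (fun j _ => mul_self_nonneg _)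
          (Finset.mem_univ i)
      rw [Set.mem_ofPred_eq.mp hx] at h1
      rw [Real.norm_eq_abs, abs_le]
      constructor <;> nlinarith
  have hne : {x : V → ℝ | x ⬝ᵥ x = 1}.Nonempty :=
    ⟨Pi.single (Classical.arbitrary V) 1, by simp⟩
  obtain ⟨x, hx, hmax⟩ := hcpt.exists_isMaxOn hne
    (f := fun x : V → ℝ => x ⬝ᵥ adjR G *ᵥ x)
    (Continuous.continuousOn (by unfold dotProduct mulVec dotProduct; fun_prop))
  have hx1 : x ⬝ᵥ x = 1 := hx
  set r := x ⬝ᵥ adjR G *ᵥ x with hr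
  have hquad : ∀ y : V → ℝ, y ⬝ᵥ (r • (1 : Matrix V V ℝ) - adjR G) *ᵥ y =
      r * (y ⬝ᵥ y) - y ⬝ᵥ adjR G *ᵥ y := by
    intro y
    simp [sub_mulVec, smul_mulVec, dotProduct_sub]
  have hle : ∀ y : V → ℝ, y ⬝ᵥ adjR G *ᵥ y ≤ r * (y ⬝ᵥ y) := by
    intro y
    rcases eq_or_ne y 0 with rfl | hy
    · simp
    have hpos : 0 < y ⬝ᵥ y := by
      have h0 : 0 ≤ y ⬝ᵥ y := Finset.sum_nonneg fun i _ => mul_self_nonneg _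
      exact lt_of_le_of_ne h0 fun h => hy (dotProduct_self_eq_zero.mp h.symm)
    set s := √(y ⬝ᵥ y) with hs
    have hs0 : 0 < s := Real.sqrt_pos.mpr hpos
    have hss : s * s = y ⬝ᵥ y := Real.mul_self_sqrt hpos.le
    have h := hmax (a := s⁻¹ • y) (by
      simp only [Set.mem_ofPred_eq, smul_dotProduct, dotProduct_smul, smul_eq_mul, ← hss]
      field_simp)
    simp only [Set.mem_ofPred_eq, mulVec_smul, smul_dotProduct, dotProduct_smul, smul_eq_mul] at h
    rw [← hss]
    have h2 := mul_le_mul_of_nonneg_right h (mul_self_nonneg s)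
    calc y ⬝ᵥ adjR G *ᵥ y = s⁻¹ * (s⁻¹ * y ⬝ᵥ adjR G *ᵥ y) * (s * s) := by field_simp
      _ ≤ _ := h2
  have hpsd : (r • (1 : Matrix V V ℝ) - adjR G).PosSemidef := by
    refine PosSemidef.of_dotProduct_mulVec_nonneg ?_ fun y => ?_
    · ext i j
      simp [adjR_comm G i j, Matrix.one_apply, eq_comm]
    · rw [star_trivial, hquad]
      linarith [hle y]
  refine ⟨r, hpsd, fun i => |x i|, fun i => abs_nonneg _, ?_, ?_⟩
  · intro h0
    have : x = 0 := funext fun i => abs_eq_zero.mp (congrFun h0 i)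
    rw [this] at hx1
    simp at hx1
  · have habs : (fun i => |x i|) ⬝ᵥ (fun i => |x i|) = 1 := by
      rw [← hx1]
      simp [dotProduct]
    have h0 := (hpsd.dotProduct_mulVec_zero_iff (fun i => |x i|)).mp (by
      rw [star_trivial, hquad]
      have h1 := hle fun i => |x i|
      have h2 := dotProduct_adjR_mulVec_le_abs G x
      rw [habs] at h1 ⊢
      linarith)
    rw [sub_mulVec, smul_mulVec, one_mulVec, sub_eq_zero] at h0
    exact h0.symm

/-- For a complex eigenvector v of eigenvalue μ, the triangle inequality gives |μ||v| ≤ A|v|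
entrywise; pairing with |v| and using the Rayleigh bound yields |μ| ≤ r. -/
theorem graphSpectralRadius_eq_ofReal [DecidableEq V] {r : ℝ}
    (hpsd : (r • (1 : Matrix V V ℝ) - adjR G).PosSemidef) {x : V → ℝ} (hx0 : ∀ i, 0 ≤ x i)
    (hx : x ≠ 0) (hAx : adjR G *ᵥ x = r • x) :
    0 ≤ r ∧ graphSpectralRadius G = ENNReal.ofReal r := by
  classical
  have hr : 0 ≤ r := by
    obtain ⟨i, hi⟩ := Function.ne_iff.mp hx
    have hi : 0 < x i := lt_of_le_of_ne (hx0 i) (Ne.symm hi)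
    have h1 : 0 ≤ (adjR G *ᵥ x) i :=
      Finset.sum_nonneg fun j _ => mul_nonneg (adjR_nonneg G i j) (hx0 j)
    rw [hAx, Pi.smul_apply, smul_eq_mul] at h1
    exact nonneg_of_mul_nonneg_left h1 hi
  refine ⟨hr, ?_⟩
  have hentry : ∀ i j, G.adjMatrix ℂ i j = ((adjR G i j : ℝ) : ℂ) := by
    intro i j
    by_cases h : G.Adj i j <;> simp [adjR, h]
  have hspec : ∀ μ : ℂ, μ ∈ spectrum ℂ (G.adjMatrix ℂ) ↔
      ∃ v : V → ℂ, v ≠ 0 ∧ G.adjMatrix ℂ *ᵥ v = μ • v := by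
    intro μ
    rw [← Matrix.spectrum_toLin', ← Module.End.hasEigenvalue_iff_mem_spectrum]
    constructor
    · intro h
      obtain ⟨v, hv⟩ := h.exists_hasEigenvector
      exact ⟨v, hv.2, by simpa using hv.apply_eq_smul⟩
    · rintro ⟨v, hv, h⟩
      exact Module.End.hasEigenvalue_of_hasEigenvector
        ⟨Module.End.mem_eigenspace_iff.mpr (by simpa using h), hv⟩
  have hnn : ENNReal.ofReal r = (‖(r : ℂ)‖₊ : ENNReal) := by
    rw [ENNReal.ofReal]
    congr 1
    ext
    simp [abs_of_nonneg hr, hr]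
  have goal_eq : graphSpectralRadius G = spectralRadius ℂ (G.adjMatrix ℂ) := by
    unfold graphSpectralRadius
    congr!
  rw [goal_eq]
  apply le_antisymm
  · refine iSup₂_le fun μ hμ => ?_
    obtain ⟨v, hv, hv2⟩ := (hspec μ).mp hμ
    have hle : ‖μ‖ ≤ r := by
      set y : V → ℝ := fun i => ‖v i‖ with hy
      have h1 : ∀ i, ‖μ‖ * y i ≤ (adjR G *ᵥ y) i := by
        intro i
        have h2 := congrFun hv2 i
        rw [Pi.smul_apply, smul_eq_mul] at h2
        calc ‖μ‖ * y i = ‖(G.adjMatrix ℂ *ᵥ v) i‖ := by rw [h2, norm_mul]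
          _ ≤ ∑ j, ‖G.adjMatrix ℂ i j * v j‖ := norm_sum_le _ _
          _ = _ := by
            refine Finset.sum_congr rfl fun j _ => ?_
            rw [norm_mul, hentry, Complex.norm_real, Real.norm_of_nonneg (adjR_nonneg G i j)]
      have h3 := hpsd.dotProduct_mulVec_nonneg y
      have h4 : ‖μ‖ * (y ⬝ᵥ y) ≤ y ⬝ᵥ adjR G *ᵥ y := by
        simp only [dotProduct, Finset.mul_sum]
        refine Finset.sum_le_sum fun i _ => ?_
        have := mul_le_mul_of_nonneg_left (h1 i) (norm_nonneg (v i))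
        calc _ = ‖v i‖ * (‖μ‖ * y i) := by simp only [hy]; ring
          _ ≤ _ := this
      have h5 : 0 < y ⬝ᵥ y := by
        have h0 : 0 ≤ y ⬝ᵥ y := Finset.sum_nonneg fun i _ => mul_self_nonneg _
        refine lt_of_le_of_ne h0 fun h => hv ?_
        have := dotProduct_self_eq_zero.mp h.symm
        exact funext fun i => norm_eq_zero.mp (congrFun this i)
      rw [star_trivial, sub_mulVec, smul_mulVec, one_mulVec, dotProduct_sub, dotProduct_smul,
        smul_eq_mul] at h3
      exact le_of_mul_le_mul_right (by linarith) h5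
    rw [hnn]
    have : ‖μ‖₊ ≤ ‖(r : ℂ)‖₊ := by
      rw [← NNReal.coe_le_coe]
      simpa [abs_of_nonneg hr] using hle
    exact_mod_cast this
  · rw [hnn]
    refine le_iSup₂_of_le (r : ℂ) ((hspec r).mpr ⟨fun i => (x i : ℂ), ?_, ?_⟩) le_rfl
    · intro h
      exact hx (funext fun i => by simpa using congrFun h i)
    · ext i
      have h := congrFun hAx i
      simp only [mulVec, dotProduct, Pi.smul_apply, smul_eq_mul] at h ⊢
      rw [← Complex.ofReal_mul, ← h]
      push_cast
      exact Finset.sum_congr rfl fun j _ => by rw [hentry]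

theorem exists_perron [Nonempty V] [DecidableEq V] :
    ∃ r : ℝ, 0 ≤ r ∧ graphSpectralRadius G = ENNReal.ofReal r ∧
      (∀ y : V → ℝ, y ⬝ᵥ adjR G *ᵥ y ≤ r * (y ⬝ᵥ y)) ∧
      ∃ x : V → ℝ, (∀ i, 0 ≤ x i) ∧ x ≠ 0 ∧ adjR G *ᵥ x = r • x := by
  obtain ⟨r, hpsd, x, hx0, hx, hAx⟩ := exists_rayleigh_max G
  obtain ⟨hr, hρ⟩ := graphSpectralRadius_eq_ofReal G hpsd hx0 hx hAx
  refine ⟨r, hr, hρ, fun y => ?_, x, hx0, hx, hAx⟩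
  have h3 := hpsd.dotProduct_mulVec_nonneg y
  rw [star_trivial, sub_mulVec, smul_mulVec, one_mulVec, dotProduct_sub, dotProduct_smul,
    smul_eq_mul] at h3
  linarith

theorem perron_pos (hG : G.Connected) {r : ℝ} {x : V → ℝ} (hx0 : ∀ i, 0 ≤ x i)
    (hx : x ≠ 0) (hAx : adjR G *ᵥ x = r • x) (i : V) : 0 < x i := by
  refine lt_of_le_of_ne (hx0 i) fun hi => hx ?_
  have step : ∀ a b, G.Adj a b → x a = 0 → x b = 0 := by
    intro a b hab ha
    have h := congrFun hAx a
    simp only [mulVec, dotProduct, Pi.smul_apply, smul_eq_mul, ha, mul_zero] at h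
    rw [Finset.sum_eq_zero_iff_of_nonneg
      fun j _ => mul_nonneg (adjR_nonneg G a j) (hx0 j)] at h
    simpa [adjR_of_adj G hab] using h b (Finset.mem_univ b)
  funext j
  have hreach := (SimpleGraph.reachable_iff_reflTransGen i j).mp (hG.preconnected i j)
  induction hreach with
  | refl => exact hi.symm
  | tail _ hab ih => exact step _ _ hab ih

/-- A vector with `xᵀ A x ≥ r xᵀ x` that is not an `r`-eigenvector forces a larger spectral
radius. -/
theorem lt_graphSpectralRadius [Nonempty V] {r : ℝ} {x : V → ℝ} (hr : 0 ≤ r)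
    (hx : r * (x ⬝ᵥ x) ≤ x ⬝ᵥ adjR G *ᵥ x) (hne : adjR G *ᵥ x ≠ r • x) :
    ENNReal.ofReal r < graphSpectralRadius G := by
  classical
  obtain ⟨s, hpsd, y, hy0, hy, hAy⟩ := exists_rayleigh_max G
  obtain ⟨hs, hρ⟩ := graphSpectralRadius_eq_ofReal G hpsd hy0 hy hAy
  rw [hρ, ENNReal.ofReal_lt_ofReal_iff_of_nonneg hr]
  by_contra! hle
  have hxx : 0 ≤ x ⬝ᵥ x := Finset.sum_nonneg fun i _ => mul_self_nonneg _
  have hquad : x ⬝ᵥ (s • (1 : Matrix V V ℝ) - adjR G) *ᵥ x =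
      s * (x ⬝ᵥ x) - x ⬝ᵥ adjR G *ᵥ x := by
    simp [sub_mulVec, smul_mulVec, dotProduct_sub]
  have h1 := hpsd.dotProduct_mulVec_nonneg x
  rw [star_trivial, hquad] at h1
  have h2 : s * (x ⬝ᵥ x) ≤ r * (x ⬝ᵥ x) := mul_le_mul_of_nonneg_right hle hxx
  have h0 := (hpsd.dotProduct_mulVec_zero_iff x).mp (by rw [star_trivial, hquad]; linarith)
  rw [sub_mulVec, smul_mulVec, one_mulVec, sub_eq_zero] at h0
  have hrs : r * (x ⬝ᵥ x) = s * (x ⬝ᵥ x) := by linarith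
  rcases eq_or_lt_of_le hxx with h | h
  · have hx0 : x = 0 := dotProduct_self_eq_zero.mp h.symm
    exact hne (by simp [hx0])
  · rw [mul_right_cancel₀ h.ne' hrs] at hne
    exact hne h0.symm

end Perron

/-! ### Invariance under isomorphism -/

section Transfer
variable {V W : Type*}

theorem InClassC.of_iso [Fintype V] [Fintype W] {G : SimpleGraph V} {H : SimpleGraph W}
    (f : G ≃g H) {n e : ℕ} (h : InClassC n e G) : InClassC n e H := by
  refine ⟨f.connected_iff.mp h.1, (Fintype.card_congr f.toEquiv).symm.trans h.2.1, ?_⟩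
  rw [← h.2.2]
  congr 1
  exact (Nat.card_congr f.mapEdgeSet).symm

theorem graphSpectralRadius_congr [Fintype V] [Fintype W] {G : SimpleGraph V} {H : SimpleGraph W}
    (f : G ≃g H) : graphSpectralRadius G = graphSpectralRadius H := by
  classical
  have hcomp : ∀ (y : W → ℝ) (i : V), (adjR G *ᵥ (y ∘ f)) i = (adjR H *ᵥ y) (f i) := by
    intro y i
    simp only [mulVec, dotProduct]
    refine Fintype.sum_equiv f.toEquiv _ _ fun j => ?_
    have : adjR G i j = adjR H (f i) (f j) := adjR_congr f.map_adj_iff.symm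
    simp [this]
  have hdot : ∀ y z : W → ℝ, (y ∘ f) ⬝ᵥ (z ∘ f) = y ⬝ᵥ z := fun y z =>
    Fintype.sum_equiv f.toEquiv _ _ fun j => rfl
  rcases isEmpty_or_nonempty V with hV | hV
  · have := f.symm.toEquiv.isEmpty
    have h1 : Subsingleton (Matrix V V ℂ) := inferInstance
    have h2 : Subsingleton (Matrix W W ℂ) := inferInstance
    simp [graphSpectralRadius, spectralRadius, spectrum.of_subsingleton]
  have hW : Nonempty W := hV.map f
  obtain ⟨r, hr, hρ, hquad, x, hx0, hx, hAx⟩ := exists_perron G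
  obtain ⟨s, hs, hσ, hquad', y, hy0, hy, hAy⟩ := exists_perron H
  rw [hρ, hσ]
  congr 1
  apply le_antisymm
  · have h := hquad' (x ∘ f.symm)
    have hxf : x = (x ∘ f.symm) ∘ f := by ext; simp
    have h2 : adjR H *ᵥ (x ∘ f.symm) = r • (x ∘ f.symm) := by
      ext j
      have := hcomp (x ∘ f.symm) (f.symm j)
      rw [← hxf, hAx] at this
      simpa using this.symm
    rw [h2, dotProduct_smul, smul_eq_mul] at h
    refine le_of_mul_le_mul_right h (lt_of_le_of_ne
      (Finset.sum_nonneg fun i _ => mul_self_nonneg _) fun h0 => hx ?_)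
    have := dotProduct_self_eq_zero.mp h0.symm
    ext i
    simpa using congrFun this (f i)
  · have h := hquad (y ∘ f)
    have h2 : adjR G *ᵥ (y ∘ f) = s • (y ∘ f) := by
      ext i
      rw [hcomp, hAy]
      rfl
    rw [h2, dotProduct_smul, smul_eq_mul] at h
    refine le_of_mul_le_mul_right h (lt_of_le_of_ne
      (Finset.sum_nonneg fun i _ => mul_self_nonneg _) fun h0 => hy ?_)
    have := dotProduct_self_eq_zero.mp h0.symm
    ext i
    simpa using congrFun this (f.symm i)

theorem AttainsMaxSpectralRadius.le [Fintype V] [Fintype W] {n e : ℕ} {G : SimpleGraph V}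
    (hG : AttainsMaxSpectralRadius n e G) {H : SimpleGraph W} (hH : InClassC n e H) :
    graphSpectralRadius H ≤ graphSpectralRadius G := by
  let φ : W ≃ Fin n := Fintype.equivFinOfCardEq hH.2.1
  let f : H ≃g H.map φ.toEmbedding := SimpleGraph.Iso.map φ H
  rw [graphSpectralRadius_congr f]
  exact hG.2 _ (hH.of_iso f)

end Transfer

/-! ### Edge rotations -/

section Rotation
variable {V : Type*}

/-- Replace the edge `wq` of a graph by the edge `wp`. -/
def rotateEdge (G : SimpleGraph V) (w p q : V) : SimpleGraph V :=
  SimpleGraph.fromEdgeSet (insert s(w, p) (G.edgeSet \ {s(w, q)}))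

variable {G : SimpleGraph V} {w p q : V}

theorem rotateEdge_adj (hwp : w ≠ p) {a b : V} :
    (rotateEdge G w p q).Adj a b ↔ s(a, b) = s(w, p) ∨ (G.Adj a b ∧ s(a, b) ≠ s(w, q)) := by
  simp only [rotateEdge, SimpleGraph.fromEdgeSet_adj, Set.mem_insert_iff, Set.mem_sdiff,
    SimpleGraph.mem_edgeSet, Set.mem_singleton_iff]
  constructor
  · exact fun h => h.1
  · refine fun h => ⟨h, ?_⟩
    rcases h with h | h
    · rintro rfl
      rw [Sym2.eq_iff] at h
      grind
    · exact h.1.ne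

theorem ncard_edgeSet_rotateEdge (hwp : w ≠ p) (hwq : G.Adj w q) (hnwp : ¬ G.Adj w p) :
    (rotateEdge G w p q).edgeSet.ncard = G.edgeSet.ncard := by
  have h : (rotateEdge G w p q).edgeSet = insert s(w, p) (G.edgeSet \ {s(w, q)}) := by
    ext z
    induction z with
    | _ a b =>
      rw [SimpleGraph.mem_edgeSet, rotateEdge_adj hwp]
      simp
  rw [h]
  exact Set.ncard_exchange (by simpa using hnwp) (by simpa using hwq)

theorem connected_rotateEdge (hG : G.Connected) (hwp : w ≠ p)
    (hr : (rotateEdge G w p q).Reachable w q) : (rotateEdge G w p q).Connected := by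
  have hne := hG.nonempty
  refine SimpleGraph.Connected.mk fun a b => ?_
  have hreach := (SimpleGraph.reachable_iff_reflTransGen a b).mp (hG.preconnected a b)
  induction hreach with
  | refl => exact SimpleGraph.Reachable.refl _
  | @tail b c _ hbc ih =>
    refine ih.trans ?_
    by_cases h : s(b, c) = s(w, q)
    · rw [Sym2.eq_iff] at h
      rcases h with ⟨rfl, rfl⟩ | ⟨rfl, rfl⟩
      · exact hr
      · exact hr.symm
    · exact ((rotateEdge_adj hwp).mpr (Or.inr ⟨hbc, h⟩)).reachable

theorem adjR_rotateEdge [DecidableEq V] (hwp : w ≠ p) (hwq : G.Adj w q) (hnwp : ¬ G.Adj w p)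
    (a b : V) : adjR (rotateEdge G w p q) a b = adjR G a b
      + (if s(a, b) = s(w, p) then 1 else 0) - (if s(a, b) = s(w, q) then 1 else 0) := by
  have hpq : s(w, p) ≠ s(w, q) := by
    intro h
    have : s(w, q) ∈ G.edgeSet := hwq
    rw [← h] at this
    exact hnwp this
  by_cases h1 : s(a, b) = s(w, p)
  · have h2 : ¬ G.Adj a b := by
      rw [← SimpleGraph.mem_edgeSet, h1]
      exact hnwp
    have h3 : (rotateEdge G w p q).Adj a b := (rotateEdge_adj hwp).mpr (Or.inl h1)
    rw [adjR_of_adj _ h3, adjR_of_not_adj _ h2, if_pos h1, if_neg (by rw [h1]; exact hpq)]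
    norm_num
  · by_cases h2 : s(a, b) = s(w, q)
    · have h3 : G.Adj a b := by
        rw [← SimpleGraph.mem_edgeSet, h2]
        exact hwq
      have h4 : ¬ (rotateEdge G w p q).Adj a b := by
        rw [rotateEdge_adj hwp]
        tauto
      rw [adjR_of_adj _ h3, adjR_of_not_adj _ h4, if_neg h1, if_pos h2]
      norm_num
    · rw [if_neg h1, if_neg h2, add_zero, sub_zero]
      by_cases h3 : G.Adj a b
      · rw [adjR_of_adj _ h3, adjR_of_adj _ ((rotateEdge_adj hwp).mpr (Or.inr ⟨h3, h2⟩))]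
      · rw [adjR_of_not_adj _ h3, adjR_of_not_adj]
        rw [rotateEdge_adj hwp]
        tauto

variable [Fintype V]

theorem sum_ite_sym2_mul [DecidableEq V] (x : V → ℝ) (hwp : w ≠ p) (a : V) :
    ∑ b, (if s(a, b) = s(w, p) then 1 else 0) * x b =
      (if a = w then x p else 0) + if a = p then x w else 0 := by
  by_cases h1 : a = w
  · subst h1
    simp [hwp]
  · by_cases h2 : a = p
    · subst h2
      simp [h1]
    · simp [h1, h2]

theorem adjR_rotateEdge_mulVec [DecidableEq V] (hwp : w ≠ p) (hwq : G.Adj w q)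
    (hnwp : ¬ G.Adj w p) (x : V → ℝ) (a : V) :
    (adjR (rotateEdge G w p q) *ᵥ x) a = (adjR G *ᵥ x) a
      + ((if a = w then x p else 0) + if a = p then x w else 0)
      - ((if a = w then x q else 0) + if a = q then x w else 0) := by
  rw [← sum_ite_sym2_mul x hwp, ← sum_ite_sym2_mul x hwq.ne]
  simp only [mulVec, dotProduct, adjR_rotateEdge hwp hwq hnwp, sub_mul, add_mul,
    Finset.sum_sub_distrib, Finset.sum_add_distrib]

/-- In a graph of maximum spectral radius, no rotation towards a vertex of larger Perron weight
keeps the graph connected. -/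
theorem AttainsMaxSpectralRadius.not_reachable_rotateEdge {n e : ℕ}
    (hG : AttainsMaxSpectralRadius n e G) {r : ℝ} (hr : 0 ≤ r)
    (hρ : graphSpectralRadius G = ENNReal.ofReal r) {x : V → ℝ} (hx : ∀ i, 0 < x i)
    (hAx : adjR G *ᵥ x = r • x) (hwp : w ≠ p) (hwq : G.Adj w q) (hnwp : ¬ G.Adj w p)
    (hqp : x q ≤ x p) : ¬ (rotateEdge G w p q).Reachable w q := by
  classical
  intro hreach
  have hne : Nonempty V := ⟨w⟩
  have hclass : InClassC n e (rotateEdge G w p q) :=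
    ⟨connected_rotateEdge hG.1.1 hwp hreach, hG.1.2.1,
      by rw [ncard_edgeSet_rotateEdge hwp hwq hnwp]; exact hG.1.2.2⟩
  refine absurd (hG.le hclass) (not_le.mpr ?_)
  rw [hρ]
  refine lt_graphSpectralRadius _ (x := x) hr ?_ ?_
  · have h : x ⬝ᵥ adjR (rotateEdge G w p q) *ᵥ x =
        x ⬝ᵥ adjR G *ᵥ x + 2 * x w * (x p - x q) := by
      simp only [dotProduct, adjR_rotateEdge_mulVec hwp hwq hnwp, mul_add, mul_sub,
        Finset.sum_add_distrib, Finset.sum_sub_distrib, mul_ite, mul_zero,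
        Finset.sum_ite_eq', Finset.mem_univ, if_true]
      ring
    rw [h, hAx, dotProduct_smul, smul_eq_mul]
    have := mul_nonneg (mul_nonneg zero_le_two (hx w).le) (sub_nonneg.mpr hqp)
    linarith
  -- Strictness survives `x p = x q`: row `p` gains `x w > 0`, so `x` is no longer an eigenvector
  -- for `r`.
  · intro h
    have hpq : p ≠ q := by
      rintro rfl
      exact hnwp hwq
    have h1 := congrFun h p
    rw [adjR_rotateEdge_mulVec hwp hwq hnwp, hAx] at h1
    simp only [hwp.symm, if_false, if_true, hpq, zero_add, add_zero, sub_zero] at h1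
    linarith [hx w]

end Rotation

/-! ### The polynomial inequality comparing cone weights -/

/-- In the slack variables a, b, c every coefficient is nonnegative. The polynomial vanishes at b =
c = 0, which is the competitor whose N is a clique on q vertices with L = q²/(q - 2); this is why
the threshold is q²/(q - 2). -/
theorem quasiStar_cubic_pos {a b c : ℝ} (ha : 0 ≤ a) (hb : 0 ≤ b) (hab : 0 < a + b) (hc : 0 < c)
    {K q M : ℝ} (hK : K = 1 + a) (hq : q = 2 + a + b) (hM : M = q ^ 2 + c) :
    0 <
    ((-4) * K ^ 1 * q ^ 1 + (-3) * K ^ 1 * q ^ 2 + 2 * K ^ 1 * q ^ 3 + 1 * K ^ 1 * q ^ 4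
      + (-9) * K ^ 2 * q ^ 1 + (-8) * K ^ 2 * q ^ 2 + 2 * K ^ 2 * q ^ 3 + 1 * K ^ 2 * q
      ^ 4 + (-6) * K ^ 3 * q ^ 1 + (-6) * K ^ 3 * q ^ 2 + (-1) * K ^ 4 * q ^ 1 + (-1) *
      K ^ 4 * q ^ 2) * (q - 2) ^ 3 +
    ((-2) * q ^ 2 + (-4) * q ^ 3 + (-2) * q ^ 4 + (-2) * K ^ 1 * q ^ 1 + (-4) * K ^ 1 *
      q ^ 2 + (-4) * K ^ 1 * q ^ 3 + (-2) * K ^ 1 * q ^ 4 + 2 * K ^ 2 * q ^ 1 + 2 * K ^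
      2 * q ^ 2) * M * (q - 2) ^ 2 +
    ((-16) + (-12) * K ^ 1 + (-12) * K ^ 1 * q ^ 1 + (-12) * K ^ 1 * q ^ 2 + 14 * K ^ 2
      + (-4) * K ^ 2 * q ^ 1 + (-4) * K ^ 2 * q ^ 2 + 12 * K ^ 3 + 2 * K ^ 4) * M ^ 2 * (q - 2) +
    ((-24) + 8 * q ^ 1 + 8 * q ^ 2 + (-36) * K ^ 1 + 4 * K ^ 1 * q ^ 1 + 4 * K ^ 1 * q ^
      2 + (-12) * K ^ 2) * M ^ 3 := by
  have hlead : 0 < 2304 * b + 384 * a * c := by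
    rcases eq_or_lt_of_le ha with rfl | ha'
    · have : 0 < b := by linarith
      positivity
    · positivity
  refine lt_of_lt_of_eq (b := 2304 * b + 384 * a * c + (
      (8128 * a + 11696 * a ^ 2 + 8900 * a ^ 3 + 3872 * a ^ 4 + 965 * a ^ 5 + 128 * a ^ 6 +
      7 * a ^ 7) * b + (7360 + 21696 * a + 25724 * a ^ 2 + 15814 * a ^ 3 + 5400 * a ^ 4 +
      1010 * a ^ 5 + 93 * a ^ 6 + 3 * a ^ 7) * b ^ 2 + (10000 + 24428 * a + 23442 * a ^ 2 +
      11274 * a ^ 3 + 2852 * a ^ 4 + 357 * a ^ 5 + 17 * a ^ 6) * b ^ 3 + (7604 + 14962 * a +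
      11136 * a ^ 2 + 3910 * a ^ 3 + 646 * a ^ 4 + 40 * a ^ 5) * b ^ 4 + (3462 + 5225 * a +
      2798 * a ^ 2 + 629 * a ^ 3 + 50 * a ^ 4) * b ^ 5 + (928 + 992 * a + 333 * a ^ 2 + 35 *
      a ^ 3) * b ^ 6 + (134 + 87 * a + 13 * a ^ 2) * b ^ 7 + (8 + 2 * a) * b ^ 8 + (1232 * a
      ^ 2 + 1604 * a ^ 3 + 1090 * a ^ 4 + 406 * a ^ 5 + 78 * a ^ 6 + 6 * a ^ 7) * c + (2112
      + 6592 * a + 8328 * a ^ 2 + 5526 * a ^ 3 + 2046 * a ^ 4 + 400 * a ^ 5 + 32 * a ^ 6) *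
      b * c + (4784 + 10996 * a + 9810 * a ^ 2 + 4306 * a ^ 3 + 940 * a ^ 4 + 82 * a ^ 5) *
      b ^ 2 * c + (4272 + 7242 * a + 4478 * a ^ 2 + 1216 * a ^ 3 + 124 * a ^ 4) * b ^ 3 * c
      + (1868 + 2208 * a + 854 * a ^ 2 + 110 * a ^ 3) * b ^ 4 * c + (396 + 288 * a + 52 * a
      ^ 2) * b ^ 5 * c + (32 + 10 * a) * b ^ 6 * c + (192 * a + 388 * a ^ 2 + 282 * a ^ 3 +
      88 * a ^ 4 + 10 * a ^ 5) * c ^ 2 + (624 + 1316 * a + 978 * a ^ 2 + 316 * a ^ 3 + 38 *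
      a ^ 4) * b * c ^ 2 + (784 + 1004 * a + 424 * a ^ 2 + 60 * a ^ 3) * b ^ 2 * c ^ 2 +
      (308 + 232 * a + 44 * a ^ 2) * b ^ 3 * c ^ 2 + (36 + 12 * a) * b ^ 4 * c ^ 2 + (24 * a
      + 20 * a ^ 2 + 4 * a ^ 3) * c ^ 3 + (60 + 44 * a + 8 * a ^ 2) * b * c ^ 3 + (12 + 4 *
      a) * b ^ 2 * c ^ 3)) ?_ ?_
  · exact add_pos_of_pos_of_nonneg hlead (by positivity)
  · subst hM hq hK
    ring

/-- The fifth powers of L cancel and the constant term vanishes, so 8(q - 2)³ times this expression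
is L times a cubic in M = L(q - 2). -/
theorem quasiStar_poly_pos {K q L : ℝ} (hK : 1 ≤ K) (hq : K + 1 ≤ q) (hq2 : 2 < q)
    (hL : q ^ 2 < L * (q - 2)) :
    0 < (K + 1) * (L - K) * (L + K / 2) * (2 * L ^ 3 +
          (1 + q * (q + 1) / 2 + (q - K) * (q + K + 1) / 2) * L ^ 2 -
          q * (q + 1) / 2 * ((q - K) * (q + K + 1) / 2)) -
        (2 * (K + 1) * L + K * ((q - K) * (q + K + 1) / 2)) *
          ((L + 1) ^ 2 * L ^ 2 - K * (K + 1) / 2 * (L ^ 2 - q * (q + 1) / 2)) := by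
  have hLpos : 0 < L := pos_of_mul_pos_left (by nlinarith) (sub_nonneg.mpr hq2.le)
  have h := quasiStar_cubic_pos (a := K - 1) (b := q - K - 1) (c := L * (q - 2) - q ^ 2)
    (K := K) (q := q) (M := L * (q - 2))
    (by linarith) (by linarith) (by linarith) (by linarith) (by ring) (by ring) (by ring)
  refine pos_of_mul_pos_left (b := 8 * (q - 2) ^ 3) ?_ (by have := sub_pos.mpr hq2; positivity)
  refine lt_of_lt_of_eq (mul_pos hLpos h) ?_
  ring

/-- The growth of the total Perron weight forced at the dominating vertex by a second dominating
vertex with `d` further neighbours, where `b` measures the walks through these neighbours. -/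
noncomputable def coneWeight (N d b l : ℝ) : ℝ :=
  (l + 1) ^ 2 * l / (l ^ 2 - b) - l - 2 + (N - d) / l

/-- Over a common denominator N cancels and the numerator of the difference is affine in T, with
coefficient -B and B ≥ 0. So the upper bound on T may be inserted, and dividing by e₁ leaves
`quasiStar_poly_pos`. -/
theorem coneWeight_lt {N e d e₁ K q L T : ℝ} (hd : 0 ≤ d) (hde : d + e₁ = e)
    (hK : 1 ≤ K) (hKe : K * (K + 1) = 2 * e₁) (hq2 : 2 < q) (hqe : q * (q + 1) = 2 * e)
    (hKq : K + 1 ≤ q) (hL : q ^ 2 < L * (q - 2)) (hb : d + T < L ^ 2)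
    (hT : (L - K) * (L + K / 2) * T ≤ K * (K + 1) * L + K ^ 2 * d / 2) :
    coneWeight N d (d + T) L < coneWeight N e e L := by
  have hLq : q + 2 < L := by
    by_contra! h
    nlinarith [mul_le_mul_of_nonneg_right h (sub_pos.mpr hq2).le]
  have hL0 : 0 < L := by linarith
  have he0 : e < L ^ 2 := by nlinarith
  have hpoly := quasiStar_poly_pos hK hKq hq2 hL
  have hd' : (q - K) * (q + K + 1) / 2 = d := by linear_combination (hqe - hKe) / 2 - hde
  have he' : q * (q + 1) / 2 = e := by linear_combination hqe / 2
  have hf' : K * (K + 1) / 2 = e₁ := by linear_combination hKe / 2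
  rw [hd', he', hf'] at hpoly
  set D := (K + 1) * (L - K) * (L + K / 2) with hD
  set B := (L + 1) ^ 2 * L ^ 2 - e₁ * (L ^ 2 - e) with hB
  have hDpos : 0 < D := by
    have : 0 < L - K := by linarith
    positivity
  have he1 : 0 < e₁ := by nlinarith
  have hBpos : 0 ≤ B := by
    have h1 : e₁ ≤ (L + 1) ^ 2 := by nlinarith
    have h2 : e₁ * (L ^ 2 - e) ≤ (L + 1) ^ 2 * L ^ 2 :=
      mul_le_mul h1 (by linarith) (by linarith) (by positivity)
    linarith
  have hDT : D * T ≤ (2 * (K + 1) * L + K * d) * e₁ := by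
    have h1 := mul_le_mul_of_nonneg_left hT (by linarith : 0 ≤ K + 1)
    have h2 : (2 * (K + 1) * L + K * d) * e₁ =
        (K + 1) * (K * (K + 1) * L + K ^ 2 * d / 2) := by rw [← hf']; ring
    rw [h2, hD]
    linarith
  have hTB : T * B < e₁ * (2 * L ^ 3 + (1 + e + d) * L ^ 2 - e * d) := by
    have h1 := mul_le_mul_of_nonneg_right hDT hBpos
    have h2 := mul_pos he1 hpoly
    refine lt_of_mul_lt_mul_left (a := D) ?_ hDpos.le
    clear_value D B
    linarith
  have hkey : e₁ * ((L ^ 2 - e) * (L ^ 2 - (d + T))) < (L + 1) ^ 2 * L ^ 2 * (e₁ - T) := by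
    rw [hB] at hTB
    have hdd : d = e - e₁ := by linarith
    rw [hdd] at hTB ⊢
    linarith
  have hx : 0 < L ^ 2 - e := by linarith
  have hy : 0 < L ^ 2 - (d + T) := by linarith
  unfold coneWeight
  have hdiff : (L + 1) ^ 2 * L / (L ^ 2 - e) - L - 2 + (N - e) / L -
      ((L + 1) ^ 2 * L / (L ^ 2 - (d + T)) - L - 2 + (N - d) / L) =
      ((L + 1) ^ 2 * L ^ 2 * (e₁ - T) - e₁ * ((L ^ 2 - e) * (L ^ 2 - (d + T)))) /
        ((L ^ 2 - e) * (L ^ 2 - (d + T)) * L) := by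
    have hdd : d = e - e₁ := by linarith
    subst hdd
    field_simp
    ring
  have : 0 < ((L + 1) ^ 2 * L ^ 2 * (e₁ - T) - e₁ * ((L ^ 2 - e) * (L ^ 2 - (d + T)))) /
        ((L ^ 2 - e) * (L ^ 2 - (d + T)) * L) := by
    apply div_pos (by linarith) (by positivity)
  linarith

/-! ### The parameters k, ℓ and the bound on n -/

section Parameters
variable {e : ℕ}

theorem cliqueParam_bounds (he : 5 ≤ e) (ht : 1 ≤ excessParam e) :
    (3 : ℝ) ≤ cliqueParam e ∧ (cliqueParam e : ℝ) * (cliqueParam e - 1) + 2 ≤ 2 * e ∧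
      2 * (e : ℝ) < cliqueParam e * (cliqueParam e + 1) := by
  have hg := isGreatest_cliqueParam e
  have h1 : (cliqueParam e).choose 2 + 1 ≤ e := by
    have := ht
    unfold excessParam at this
    omega
  have h2 : e < (cliqueParam e + 1).choose 2 := by
    by_contra! h
    have : cliqueParam e + 1 ≤ cliqueParam e := hg.2 h
    omega
  refine ⟨?_, ?_, ?_⟩
  · exact_mod_cast hg.2 (show Nat.choose 3 2 ≤ e by simp [Nat.choose]; omega)
  · have : (((cliqueParam e).choose 2 + 1 : ℕ) : ℝ) ≤ e := by exact_mod_cast h1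
    push_cast [Nat.cast_choose_two] at this
    linarith
  · have : (e : ℝ) < ((cliqueParam e + 1).choose 2 : ℕ) := by exact_mod_cast h2
    push_cast [Nat.cast_choose_two] at this
    linarith

theorem cliqueParam_add_one_lt (he : 5 ≤ e) (ht : 1 ≤ excessParam e) :
    (cliqueParam e : ℝ) + 1 < e := by
  obtain ⟨h1, h2, h3⟩ := cliqueParam_bounds he ht
  have h5 : (5 : ℝ) ≤ e := by exact_mod_cast he
  rcases Nat.lt_or_ge 3 (cliqueParam e) with h | h
  · have : (4 : ℝ) ≤ cliqueParam e := by exact_mod_cast h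
    nlinarith
  · have : (cliqueParam e : ℝ) ≤ 3 := by exact_mod_cast h
    linarith

/-- A clique on q + 1 vertices has q(q + 1)/2 edges; a real q interpolates between cliques. -/
theorem exists_triangularRoot {m : ℝ} (hm : 1 ≤ m) : ∃ q : ℝ, 1 ≤ q ∧ q * (q + 1) = 2 * m := by
  have h := Real.sq_sqrt (show (0 : ℝ) ≤ 1 + 8 * m by linarith)
  have h3 : 3 ≤ √(1 + 8 * m) := Real.le_sqrt_of_sq_le (by linarith)
  exact ⟨(√(1 + 8 * m) - 1) / 2, by linarith, by linear_combination h / 4⟩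

/-- The function ek/(e - k - 1) increases in k and equals q²/(q - 2) at k = q, because 2(e - q - 1)
= (q - 2)(q + 1). Maximality of k gives q < k. -/
theorem sq_lt_ellParam_mul (he : 5 ≤ e) (ht : 1 ≤ excessParam e) {q : ℝ} (hq : 1 ≤ q)
    (hqe : q * (q + 1) = 2 * e) : 2 < q ∧ q ^ 2 < ellParam e * (q - 2) := by
  obtain ⟨h1, h2, h3⟩ := cliqueParam_bounds he ht
  have h4 := cliqueParam_add_one_lt he ht
  have h5 : (5 : ℝ) ≤ e := by exact_mod_cast he
  have hq2 : 2 < q := by nlinarith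
  have hqk : q < cliqueParam e := by nlinarith
  refine ⟨hq2, ?_⟩
  have hden : (0 : ℝ) < e - cliqueParam e - 1 := by linarith
  unfold ellParam
  rw [div_mul_eq_mul_div, lt_div_iff₀ hden]
  have he' : (e : ℝ) = q * (q + 1) / 2 := by linarith
  have hprod : 0 < q * (q + 1) * (q - 2 + 2) * (cliqueParam e - q) := by
    have := sub_pos.mpr hqk
    have : 0 < q - 2 + 2 := by linarith
    positivity
  rw [he']
  nlinarith [mul_pos (mul_pos (by linarith : 0 < q) (by linarith : 0 < q - 1)) (sub_pos.mpr hqk),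
    mul_pos (by linarith : 0 < q) (sub_pos.mpr hqk),
    mul_pos (mul_pos (by linarith : 0 < q) (by linarith : 0 < q)) (sub_pos.mpr hqk)]

theorem ellParam_bounds (he : 5 ≤ e) (ht : 1 ≤ excessParam e) :
    0 < ellParam e ∧ (e : ℝ) < ellParam e ^ 2 ∧ 0 < ellParam e ^ 2 - ellParam e - 2 * e := by
  have h5 : (5 : ℝ) ≤ e := by exact_mod_cast he
  obtain ⟨q, hq, hqe⟩ := exists_triangularRoot (m := e) (by linarith)
  obtain ⟨hq2, hL⟩ := sq_lt_ellParam_mul he ht hq hqe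
  have hLq : q + 2 < ellParam e := by
    by_contra! h
    nlinarith [mul_le_mul_of_nonneg_right h (sub_pos.mpr hq2).le]
  refine ⟨by linarith, by nlinarith, by nlinarith⟩

theorem ellParam_lt_coneWeight (he : 5 ≤ e) (ht : 1 ≤ excessParam e) {n : ℝ}
    (hn : n > (e : ℝ) + 2 +
      ellParam e * (ellParam e + 1) * (ellParam e ^ 2 - ellParam e - 2 * (e : ℝ)) /
        (ellParam e ^ 2 - (e : ℝ))) :
    (e : ℝ) + 2 < n ∧ ellParam e < coneWeight (n - 2) e e (ellParam e) := by
  obtain ⟨h1, h2, h3⟩ := ellParam_bounds he ht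
  set l := ellParam e
  have h4 : 0 < l ^ 2 - e := by linarith
  have h5 : 0 < l * (l + 1) * (l ^ 2 - l - 2 * (e : ℝ)) / (l ^ 2 - (e : ℝ)) := by positivity
  refine ⟨by linarith, ?_⟩
  unfold coneWeight
  have h6 : (l + 1) ^ 2 * l / (l ^ 2 - e) - l - 2 + (n - 2 - e) / l - l =
      (n - (e + 2 + l * (l + 1) * (l ^ 2 - l - 2 * (e : ℝ)) / (l ^ 2 - (e : ℝ)))) / l := by
    field_simp
    ring
  have h7 : 0 < (n - (e + 2 + l * (l + 1) * (l ^ 2 - l - 2 * (e : ℝ)) / (l ^ 2 - (e : ℝ)))) / l :=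
    div_pos (by linarith) h1
  linarith

end Parameters

/-! ### Bounding walks inside N -/

section WalkBound
variable {ι : Type*} (N : Finset ι) (a : ι → ι → ℝ)

/-- Two bounds on the 2-walks from i, one quadratic and one linear in the degree D, are replaced by
a single affine bound: the chord of the quadratic through D = 1 and D = K. It is attained by a
clique on K + 1 vertices. -/
theorem sum_mul_degree_le (h01 : ∀ i j, a i j = 0 ∨ a i j = 1) (hsymm : ∀ i j, a i j = a j i)
    (hdiag : ∀ i, a i i = 0) {f K : ℝ} (hf : ∑ i ∈ N, ∑ j ∈ N, a i j = 2 * f) (hK : 1 ≤ K)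
    (hKf : K * (K + 1) = 2 * f) {i : ι} (hi : i ∈ N) :
    ∑ j ∈ N, a i j * ∑ k ∈ N, a j k ≤ f - K / 2 + K / 2 * ∑ j ∈ N, a i j := by
  classical
  have h0 : ∀ i j, 0 ≤ a i j := fun i j => by rcases h01 i j with h | h <;> rw [h]; norm_num
  have h1 : ∀ i j, a i j ≤ 1 := fun i j => by rcases h01 i j with h | h <;> rw [h]; norm_num
  set D := ∑ j ∈ N, a i j with hD
  have hD0 : 0 ≤ D := Finset.sum_nonneg fun j _ => h0 i j
  have hKsq : K ≤ f := by nlinarith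
  -- An edge jk is counted once for each end adjacent to i, hence twice only inside the
  -- neighbourhood of i, which has at most D(D - 1)/2 pairs.
  have hm1 : 2 * ∑ j ∈ N, a i j * ∑ k ∈ N, a j k ≤ 2 * f + D ^ 2 - D := by
    have e1 : ∑ j ∈ N, a i j * ∑ k ∈ N, a j k = ∑ j ∈ N, ∑ k ∈ N, a i j * a j k := by
      simp only [Finset.mul_sum]
    have e2 : ∑ j ∈ N, a i j * ∑ k ∈ N, a j k = ∑ j ∈ N, ∑ k ∈ N, a i k * a j k := by
      rw [e1, Finset.sum_comm]
      simp only [hsymm]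
    have e3 : D ^ 2 = ∑ j ∈ N, ∑ k ∈ N, a i j * a i k := by
      rw [hD, sq, Finset.sum_mul_sum]
    have e4 : D = ∑ j ∈ N, ∑ k ∈ N, if j = k then a i j else 0 := by
      simp +contextual [hD]
    rw [two_mul]
    nth_rewrite 1 [e1]
    rw [e2, ← hf, e3, e4]
    simp only [← Finset.sum_add_distrib, ← Finset.sum_sub_distrib]
    refine Finset.sum_le_sum fun j _ => Finset.sum_le_sum fun k _ => ?_
    split_ifs with hjk
    · subst hjk
      rw [hdiag]
      rcases h01 i j with h | h <;> rw [h] <;> norm_num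
    · rcases h01 i j with h | h <;> rcases h01 i k with h' | h' <;> rw [h, h'] <;>
        linarith [h0 j k, h1 j k]
  -- All degrees other than that of i sum to 2f - D.
  have hm2 : ∑ j ∈ N, a i j * ∑ k ∈ N, a j k ≤ 2 * f - D := by
    rw [← hf, hD, le_sub_iff_add_le]
    calc _ ≤ ∑ j ∈ N, ((if j = i then 0 else ∑ k ∈ N, a j k) +
            if j = i then ∑ k ∈ N, a j k else 0) := by
          rw [Finset.sum_add_distrib]
          refine add_le_add (Finset.sum_le_sum fun j _ => ?_) ?_
          · split_ifs with hji
            · rw [hji, hdiag, zero_mul]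
            · exact mul_le_of_le_one_left (Finset.sum_nonneg fun k _ => h0 j k) (h1 i j)
          · simp [hi]
      _ = _ := Finset.sum_congr rfl fun j _ => by split_ifs <;> simp
  rcases le_or_gt K D with hKD | hKD
  · nlinarith
  -- For D < K the chord dominates when (D - 1)(K - D) ≥ 0, so D = 0 has to be treated apart.
  · by_cases hz : ∀ j ∈ N, a i j = 0
    · have : ∑ j ∈ N, a i j * ∑ k ∈ N, a j k = 0 :=
        Finset.sum_eq_zero fun j hj => by rw [hz j hj, zero_mul]
      rw [this]
      nlinarith
    · push Not at hz
      obtain ⟨j, hj, hne⟩ := hz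
      have h2 : a i j ≤ D := Finset.single_le_sum (fun k _ => h0 i k) hj
      rw [(h01 i j).resolve_left hne] at h2
      nlinarith

/-- An upper bound for the degree-weighted sum of a solution of `(l - a) z = 1`. -/
theorem degree_weighted_sum_le (h01 : ∀ i j, a i j = 0 ∨ a i j = 1)
    (hsymm : ∀ i j, a i j = a j i) (hdiag : ∀ i, a i i = 0) {f K : ℝ}
    (hf : ∑ i ∈ N, ∑ j ∈ N, a i j = 2 * f) (hK : 1 ≤ K) (hKf : K * (K + 1) = 2 * f) {l : ℝ}
    (hl : 0 < l) {z : ι → ℝ} (hz : ∀ i ∈ N, 0 ≤ z i)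
    (heq : ∀ i ∈ N, l * z i = 1 + ∑ j ∈ N, a i j * z j) :
    (l - K) * (l + K / 2) * ∑ i ∈ N, (∑ j ∈ N, a i j) * z i ≤
      K * (K + 1) * l + K ^ 2 * (N.card : ℝ) / 2 := by
  set T := ∑ i ∈ N, (∑ j ∈ N, a i j) * z i with hT
  set S := ∑ i ∈ N, z i with hS
  have hswap : ∀ w : ι → ℝ, ∑ i ∈ N, w i * ∑ j ∈ N, a i j * z j =
      ∑ j ∈ N, (∑ i ∈ N, a j i * w i) * z j := by
    intro w
    simp only [Finset.mul_sum, Finset.sum_mul]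
    rw [Finset.sum_comm]
    refine Finset.sum_congr rfl fun i _ => Finset.sum_congr rfl fun j _ => ?_
    rw [hsymm i j]
    ring
  have hlS : l * S = N.card + T := by
    rw [hS, Finset.mul_sum, Finset.sum_congr rfl heq, Finset.sum_add_distrib, hT]
    have := hswap fun _ => 1
    simp only [one_mul, mul_one] at this
    rw [this]
    simp
  have hlT : l * T = 2 * f + ∑ i ∈ N, (∑ j ∈ N, a i j * ∑ k ∈ N, a j k) * z i := by
    rw [← hswap, ← hf, hT, Finset.mul_sum, ← Finset.sum_add_distrib]
    refine Finset.sum_congr rfl fun i hi => ?_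
    calc _ = (∑ j ∈ N, a i j) * (l * z i) := by ring
      _ = _ := by rw [heq i hi]; ring
  have hle : ∑ i ∈ N, (∑ j ∈ N, a i j * ∑ k ∈ N, a j k) * z i ≤ (f - K / 2) * S + K / 2 * T := by
    rw [hS, hT, Finset.mul_sum, Finset.mul_sum, ← Finset.sum_add_distrib]
    refine Finset.sum_le_sum fun i hi => ?_
    have := mul_le_mul_of_nonneg_right
      (sum_mul_degree_le N a h01 hsymm hdiag hf hK hKf hi) (hz i hi)
    linarith
  -- Multiplying by `l` once more lets `hlS` eliminate S. With f - K/2 = K²/2, the coefficient of T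
  -- factors as (l - K)(l + K/2).
  have h1 : l * (l * T) ≤ l * (2 * f) + (f - K / 2) * (N.card + T) + K / 2 * (l * T) := by
    calc _ ≤ l * (2 * f + ((f - K / 2) * S + K / 2 * T)) :=
          mul_le_mul_of_nonneg_left (by linarith) hl.le
      _ = _ := by rw [← hlS]; ring
  have hfK : f = K * (K + 1) / 2 := by linarith
  rw [hfK] at h1
  linarith

theorem sum_sum_le_card_mul (h1 : ∀ i j, a i j ≤ 1) (hdiag : ∀ i, a i i = 0) :
    ∑ i ∈ N, ∑ j ∈ N, a i j ≤ (N.card : ℝ) * ((N.card : ℝ) - 1) := by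
  classical
  calc _ ≤ ∑ i ∈ N, ∑ j ∈ N, (1 - if i = j then 1 else 0 : ℝ) := by
        refine Finset.sum_le_sum fun i _ => Finset.sum_le_sum fun j _ => ?_
        split_ifs with h
        · rw [h, hdiag]; norm_num
        · simpa using h1 i j
    _ = _ := by
        have : ∀ i ∈ N, ∑ j ∈ N, (1 - if i = j then 1 else 0 : ℝ) = N.card - 1 := by
          intro i hi
          simp [Finset.sum_sub_distrib, hi]
        rw [Finset.sum_congr rfl this, Finset.sum_const, nsmul_eq_mul]

end WalkBound

/-! ### Edge counts and the graph V -/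

theorem sum_adjR {V : Type*} [Fintype V] (G : SimpleGraph V) :
    ∑ i, ∑ j, adjR G i j = 2 * (G.edgeSet.ncard : ℝ) := by
  classical
  have h := G.sum_degrees_eq_twice_card_edges
  have h1 : G.edgeSet.ncard = G.edgeFinset.card := by
    rw [← SimpleGraph.coe_edgeFinset, Set.ncard_coe_finset]
  have h2 : ∀ i, ∑ j, adjR G i j = (G.degree i : ℝ) := by
    intro i
    rw [← SimpleGraph.card_neighborFinset_eq_degree, SimpleGraph.neighborFinset_eq_filter]
    simp [adjR]
  simp only [h2, h1]
  exact_mod_cast h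

section GraphV
variable (n e : ℕ)

theorem graphV_adj_apex (i) : (graphV n e).Adj (Sum.inr 0) i ↔ i ≠ Sum.inr 0 := by
  rcases i with i | i
  · simp [graphV, graphJoin]
  · simp [graphV, graphJoin, Subsingleton.elim i 0]

theorem graphV_adj_inl (i j) : (graphV n e).Adj (Sum.inl i) (Sum.inl j) ↔
    (SimpleGraph.sum (completeBipartiteGraph (Fin 1) (Fin e))
      (⊥ : SimpleGraph (Fin (n - e - 2)))).Adj i j := by
  simp [graphV, graphJoin]

variable {n e}

theorem graphV_connected : (graphV n e).Connected := by
  have h : ∀ i, (graphV n e).Reachable (Sum.inr 0) i := by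
    intro i
    by_cases hi : i = Sum.inr 0
    · rw [hi]
    · exact ((graphV_adj_apex n e i).mpr hi).reachable
  have : Nonempty (((Fin 1 ⊕ Fin e) ⊕ Fin (n - e - 2)) ⊕ Fin 1) := ⟨Sum.inr 0⟩
  exact SimpleGraph.Connected.mk fun i j => (h i).symm.trans (h j)

theorem adjR_graphV_mulVec (x : ((Fin 1 ⊕ Fin e) ⊕ Fin (n - e - 2)) ⊕ Fin 1 → ℝ) :
    adjR (graphV n e) *ᵥ x = Sum.elim
      (Sum.elim
        (Sum.elim (fun _ => x (Sum.inr 0) + ∑ j, x (Sum.inl (Sum.inl (Sum.inr j))))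
          fun _ => x (Sum.inr 0) + x (Sum.inl (Sum.inl (Sum.inl 0))))
        fun _ => x (Sum.inr 0))
      fun _ => x (Sum.inl (Sum.inl (Sum.inl 0))) + ∑ j, x (Sum.inl (Sum.inl (Sum.inr j))) +
        ∑ j, x (Sum.inl (Sum.inr j)) := by
  have h1 : ∀ i, adjR (graphV n e) (Sum.inl i) (Sum.inr 0) = 1 := fun i =>
    adjR_of_adj _ ((graphV_adj_apex n e _).mpr (by simp)).symm
  have h2 : ∀ i, adjR (graphV n e) (Sum.inr 0) (Sum.inl i) = 1 := fun i => by
    rw [adjR_comm, h1]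
  have h3 : adjR (graphV n e) (Sum.inr 0) (Sum.inr 0) = 0 := adjR_of_not_adj _ (by simp)
  have h4 : ∀ i j, adjR (graphV n e) (Sum.inl i) (Sum.inl j) = adjR (SimpleGraph.sum
      (completeBipartiteGraph (Fin 1) (Fin e)) (⊥ : SimpleGraph (Fin (n - e - 2)))) i j :=
    fun i j => adjR_congr (graphV_adj_inl n e i j)
  funext i
  simp only [mulVec, dotProduct, Fintype.sum_sum_type, Finset.univ_unique, Fin.default_eq_zero,
    Finset.sum_singleton]
  rcases i with ((i | i) | i) | i
  · simp only [h1, h4]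
    simp [adjR, add_comm]
  · simp only [h1, h4]
    simp [adjR, add_comm]
  · simp only [h1, h4]
    simp [adjR]
  · rw [Subsingleton.elim i 0]
    simp [h2, h3]

theorem inClassC_graphV (hn : e + 2 ≤ n) : InClassC n e (graphV n e) := by
  refine ⟨graphV_connected, by simp; omega, ?_⟩
  have h := sum_adjR (graphV n e)
  have h1 : ∀ i, ∑ j, adjR (graphV n e) i j = (adjR (graphV n e) *ᵥ fun _ => 1) i := by
    intro i
    simp [mulVec, dotProduct]
  have h2 : ((n - e - 2 : ℕ) : ℝ) = n - e - 2 := by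
    rw [Nat.sub_sub, Nat.cast_sub hn]
    push_cast
    ring
  simp only [h1, adjR_graphV_mulVec, Fintype.sum_sum_type] at h
  simp [h2] at h
  have : ((graphV n e).edgeSet.ncard : ℝ) + 1 = n + e := by linarith
  exact_mod_cast this

theorem lt_graphSpectralRadius_graphV (hn : e + 2 ≤ n) {l : ℝ} (hl : 0 < l)
    (hel : (e : ℝ) < l ^ 2) (hw : l < coneWeight (n - 2) e e l) :
    ENNReal.ofReal l < graphSpectralRadius (graphV n e) := by
  have hpos : 0 < l ^ 2 - e := by linarith
  have h2 : ((n - e - 2 : ℕ) : ℝ) = n - 2 - e := by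
    rw [Nat.sub_sub, Nat.cast_sub hn]
    push_cast
    ring
  set x : ((Fin 1 ⊕ Fin e) ⊕ Fin (n - e - 2)) ⊕ Fin 1 → ℝ :=
    Sum.elim (Sum.elim (Sum.elim (fun _ => (l + e) / (l ^ 2 - e))
      fun _ => (l + 1) / (l ^ 2 - e)) fun _ => 1 / l) fun _ => 1 with hx
  -- The vector `x` solves every row of the eigenvalue equation for `l` except that of the apex,
  -- where the residual is positive by `hw`.
  have hA : adjR (graphV n e) *ᵥ x =
      l • x + Pi.single (Sum.inr 0) (coneWeight (n - 2) e e l - l) := by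
    rw [adjR_graphV_mulVec]
    ext i
    rcases i with ((i | i) | i) | i
    · simp [hx]
      field_simp
      ring
    · simp [hx]
      field_simp
      ring
    · simp [hx, hl.ne']
    · rw [Subsingleton.elim i 0]
      simp only [hx, Sum.elim_inr, Sum.elim_inl, Pi.add_apply, Pi.smul_apply, smul_eq_mul,
        Pi.single_eq_same, Finset.sum_const, Finset.card_univ, Fintype.card_fin, nsmul_eq_mul, h2,
        coneWeight]
      field_simp
      ring
  have : Nonempty (((Fin 1 ⊕ Fin e) ⊕ Fin (n - e - 2)) ⊕ Fin 1) := ⟨Sum.inr 0⟩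
  refine lt_graphSpectralRadius _ (x := x) hl.le ?_ ?_
  · rw [hA, dotProduct_add, dotProduct_smul, smul_eq_mul, dotProduct_single]
    have : x (Sum.inr 0) = 1 := rfl
    rw [this]
    linarith
  · rw [hA]
    intro h
    have := congrFun h (Sum.inr 0)
    simp at this
    linarith

theorem nonempty_iso_graphV {W : Type*} [Fintype W] (G : SimpleGraph W) (hn : e + 2 ≤ n)
    (hcard : Fintype.card W = n) {u v : W} {N : Finset W} (hN : N.card = e) (huv : u ≠ v)
    (huN : u ∉ N) (hvN : v ∉ N) (hu : ∀ i, i ≠ u → G.Adj u i)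
    (hv : ∀ i, i ≠ u → (G.Adj v i ↔ i ∈ N))
    (hrest : ∀ i j, i ≠ u → j ≠ u → i ≠ v → j ≠ v → ¬ G.Adj i j) :
    Nonempty (G ≃g graphV n e) := by
  classical
  set R : Finset W := Finset.univ \ insert u (insert v N) with hR
  have hRcard : R.card = n - e - 2 := by
    rw [hR, Finset.card_sdiff_of_subset (Finset.subset_univ _), Finset.card_univ, hcard,
      Finset.card_insert_of_notMem (by simp [huv, huN]), Finset.card_insert_of_notMem hvN, hN]
    omega
  have hRmem : ∀ i ∈ R, i ≠ u ∧ i ≠ v ∧ i ∉ N := by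
    intro i hi
    simpa [hR] using hi
  let φ : N ≃ Fin e := N.equivFinOfCardEq hN
  let ψ : R ≃ Fin (n - e - 2) := R.equivFinOfCardEq hRcard
  let f : ((Fin 1 ⊕ Fin e) ⊕ Fin (n - e - 2)) ⊕ Fin 1 → W :=
    Sum.elim (Sum.elim (Sum.elim (fun _ => v) fun i => φ.symm i) fun i => ψ.symm i) fun _ => u
  have hφ : ∀ i, (φ.symm i : W) ∈ N := fun i => (φ.symm i).2
  have hψ : ∀ i, (ψ.symm i : W) ∈ R := fun i => (ψ.symm i).2
  have hφu : ∀ i, (φ.symm i : W) ≠ u := fun i h => huN (h ▸ hφ i)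
  have hφv : ∀ i, (φ.symm i : W) ≠ v := fun i h => hvN (h ▸ hφ i)
  have hψu : ∀ i, (ψ.symm i : W) ≠ u := fun i => (hRmem _ (hψ i)).1
  have hψv : ∀ i, (ψ.symm i : W) ≠ v := fun i => (hRmem _ (hψ i)).2.1
  have hψN : ∀ i, (ψ.symm i : W) ∉ N := fun i => (hRmem _ (hψ i)).2.2
  have hφψ : ∀ i j, (φ.symm i : W) ≠ ψ.symm j := fun i j h => hψN j (h ▸ hφ i)
  have hinj : Function.Injective f := by
    rintro (((i | i) | i) | i) (((j | j) | j) | j) h <;>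
      simp only [f, Sum.elim_inl, Sum.elim_inr] at h
    · rw [Subsingleton.elim i j]
    · exact absurd h.symm (hφv j)
    · exact absurd h.symm (hψv j)
    · exact absurd h.symm huv
    · exact absurd h (hφv i)
    · rw [φ.symm.injective (Subtype.ext h)]
    · exact absurd h (hφψ i j)
    · exact absurd h (hφu i)
    · exact absurd h (hψv i)
    · exact absurd h.symm (hφψ j i)
    · rw [ψ.symm.injective (Subtype.ext h)]
    · exact absurd h (hψu i)
    · exact absurd h huv
    · exact absurd h.symm (hφu j)
    · exact absurd h.symm (hψu j)
    · rw [Subsingleton.elim i j]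
  have hbij : Function.Bijective f := by
    refine (Fintype.bijective_iff_injective_and_card f).mpr ⟨hinj, ?_⟩
    simp [hcard]
    omega
  have hfu : ∀ i, f (Sum.inl i) ≠ u := by
    rintro ((i | i) | i)
    · exact huv.symm
    · exact hφu i
    · exact hψu i
  have hadj : ∀ a b, G.Adj (f a) (f b) ↔ (graphV n e).Adj a b := by
    rintro (a | a) (b | b)
    · rw [graphV_adj_inl]
      rcases a with (a | a) | a <;> rcases b with (b | b) | b <;>
        simp only [f, Sum.elim_inl, Sum.elim_inr]
      · simp
      · simp [hv _ (hφu b)]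
      · simp [hv _ (hψu b), hψN]
      · rw [G.adj_comm]
        simp [hv _ (hφu a)]
      · simp [hrest _ _ (hφu a) (hφu b) (hφv a) (hφv b)]
      · simp [hrest _ _ (hφu a) (hψu b) (hφv a) (hψv b)]
      · rw [G.adj_comm]
        simp [hv _ (hψu a), hψN]
      · simp [hrest _ _ (hψu a) (hφu b) (hψv a) (hφv b)]
      · simp [hrest _ _ (hψu a) (hψu b) (hψv a) (hψv b)]
    · rw [Subsingleton.elim b 0, G.adj_comm, (graphV n e).adj_comm, graphV_adj_apex]
      exact iff_of_true (hu _ (hfu a)) (by simp)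
    · rw [Subsingleton.elim a 0, graphV_adj_apex]
      exact iff_of_true (hu _ (hfu b)) (by simp)
    · rw [Subsingleton.elim a b]
      simp
  exact ⟨(RelIso.mk (Equiv.ofBijective f hbij) (hadj _ _) : graphV n e ≃g G).symm⟩

end GraphV

/-! ### Structure of extremal graphs -/

section Extremal
variable {W : Type*} [Fintype W] {G : SimpleGraph W} {n e : ℕ} {r : ℝ} {x : W → ℝ}

/-- Along a walk u, …, b, c with u adjacent to b but not to c, rotating cb to cu would keep the
graph connected through the path c, u, b. -/
theorem AttainsMaxSpectralRadius.adj_of_isMax (hG : AttainsMaxSpectralRadius n e G) (hr : 0 ≤ r)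
    (hρ : graphSpectralRadius G = ENNReal.ofReal r) (hx : ∀ i, 0 < x i)
    (hAx : adjR G *ᵥ x = r • x) {u : W} (hu : ∀ i, x i ≤ x u) {i : W} (hi : i ≠ u) :
    G.Adj u i := by
  have hreach := (SimpleGraph.reachable_iff_reflTransGen u i).mp (hG.1.1.preconnected u i)
  suffices h : i = u ∨ G.Adj u i from h.resolve_left hi
  clear hi
  induction hreach with
  | refl => exact Or.inl rfl
  | @tail b c _ hbc ih =>
    by_contra! h
    obtain ⟨hcu, huc⟩ := h
    rcases ih with rfl | hub
    · exact huc hbc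
    · refine hG.not_reachable_rotateEdge hr hρ hx hAx hcu hbc.symm
        (fun h => huc h.symm) (hu b) ?_
      refine SimpleGraph.Reachable.trans (v := u)
        ((rotateEdge_adj hcu).mpr (Or.inl rfl)).reachable
        ((rotateEdge_adj hcu).mpr (Or.inr ⟨hub, fun h => ?_⟩)).reachable
      rw [Sym2.eq_iff] at h
      rcases h with h | h
      · exact hcu h.1.symm
      · exact hub.ne h.1

/-- The dominating vertex keeps every rotation away from it connected, so neighbourhoods are nested
in the order of the Perron entries. -/
theorem AttainsMaxSpectralRadius.adj_of_le (hG : AttainsMaxSpectralRadius n e G) (hr : 0 ≤ r)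
    (hρ : graphSpectralRadius G = ENNReal.ofReal r) (hx : ∀ i, 0 < x i)
    (hAx : adjR G *ᵥ x = r • x) {u : W} (hu : ∀ i, i ≠ u → G.Adj u i) {p q w : W}
    (hp : p ≠ u) (hq : q ≠ u) (hqp : x q ≤ x p) (hwq : G.Adj w q) (hwp : w ≠ p) :
    G.Adj w p := by
  by_contra hnwp
  have hwu : w ≠ u := by
    rintro rfl
    exact hnwp (hu p hp)
  refine hG.not_reachable_rotateEdge hr hρ hx hAx hwp hwq hnwp hqp ?_
  refine SimpleGraph.Reachable.trans (v := u)
    ((rotateEdge_adj hwp).mpr (Or.inr ⟨(hu w hwu).symm, fun h => ?_⟩)).reachable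
    ((rotateEdge_adj hwp).mpr (Or.inr ⟨hu q hq, fun h => ?_⟩)).reachable
  · rw [Sym2.eq_iff] at h
    rcases h with h | h
    · exact hq h.2.symm
    · exact hwq.ne h.1
  · rw [Sym2.eq_iff] at h
    rcases h with h | h
    · exact hwu h.1.symm
    · exact hq h.1.symm

/-- A graph of maximum spectral radius has a dominating vertex `u` and a second vertex `v` whose
neighbourhood contains every edge avoiding `u` and `v`. -/
theorem AttainsMaxSpectralRadius.exists_dominating_pair (hG : AttainsMaxSpectralRadius n e G)
    (hn : 2 ≤ n) (hr : 0 ≤ r) (hρ : graphSpectralRadius G = ENNReal.ofReal r)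
    (hx : ∀ i, 0 < x i) (hAx : adjR G *ᵥ x = r • x) :
    ∃ u v : W, ∃ N : Finset W, u ≠ v ∧ u ∉ N ∧ v ∉ N ∧ (∀ i, i ≠ u → G.Adj u i) ∧
      (∀ i, i ≠ u → (G.Adj v i ↔ i ∈ N)) ∧
      ∀ i j, i ≠ u → j ≠ u → i ≠ v → j ≠ v → G.Adj i j → j ∈ N := by
  classical
  have hcard : Fintype.card W = n := hG.1.2.1
  have hne : Nonempty W := hG.1.1.nonempty
  obtain ⟨u, hmax⟩ := Finite.exists_max x
  have hu : ∀ i, i ≠ u → G.Adj u i := fun i => hG.adj_of_isMax hr hρ hx hAx hmax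
  have hnt : (Finset.univ.erase u).Nonempty := by
    rw [← Finset.card_pos, Finset.card_erase_of_mem (Finset.mem_univ u), Finset.card_univ]
    omega
  obtain ⟨v, hv, hvmax⟩ := Finset.exists_max_image _ x hnt
  have hvu : v ≠ u := Finset.ne_of_mem_erase hv
  have hvmax : ∀ i, i ≠ u → x i ≤ x v := fun i hi =>
    hvmax i (Finset.mem_erase.mpr ⟨hi, Finset.mem_univ i⟩)
  refine ⟨u, v, Finset.univ.filter fun i => i ≠ u ∧ G.Adj v i, hvu.symm, by simp, by simp, hu,
    by simp +contextual, fun i j hi hj hiv hjv hij => ?_⟩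
  simp only [Finset.mem_filter, Finset.mem_univ, true_and]
  exact ⟨hj, (hG.adj_of_le hr hρ hx hAx hu hvu hi (hvmax i hi) hij.symm hjv).symm⟩

end Extremal

/-! ### Eigenvalue equations around the dominating pair -/

section DominatingPair
variable {W : Type*} [Fintype W] {G : SimpleGraph W} {u v : W} {N : Finset W}

theorem sum_eq_add_add_sum_add_sum [DecidableEq W] (huv : u ≠ v) (huN : u ∉ N) (hvN : v ∉ N)
    (F : W → ℝ) : ∑ i, F i =
      F u + F v + ∑ i ∈ N, F i + ∑ i ∈ Finset.univ \ insert u (insert v N), F i := by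
  rw [← Finset.sum_sdiff (Finset.subset_univ (insert u (insert v N))),
    Finset.sum_insert (by simp [huv, huN]), Finset.sum_insert hvN]
  ring

theorem adjR_mulVec_dominating [DecidableEq W] (huv : u ≠ v) (huN : u ∉ N) (hvN : v ∉ N)
    (hu : ∀ i, i ≠ u → G.Adj u i) (x : W → ℝ) :
    (adjR G *ᵥ x) u = x v + ∑ i ∈ N, x i + ∑ i ∈ Finset.univ \ insert u (insert v N), x i := by
  simp only [mulVec, dotProduct]
  rw [sum_eq_add_add_sum_add_sum huv huN hvN, adjR_of_not_adj G (G.loopless.irrefl u),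
    adjR_of_adj G (hu v huv.symm), zero_mul, one_mul, zero_add]
  congr 1
  · congr 1
    refine Finset.sum_congr rfl fun i hi => ?_
    rw [adjR_of_adj G (hu i fun h => huN (h ▸ hi)), one_mul]
  · refine Finset.sum_congr rfl fun i hi => ?_
    have : i ≠ u := by
      rintro rfl
      simp at hi
    rw [adjR_of_adj G (hu i this), one_mul]

theorem adjR_mulVec_second (huv : u ≠ v) (huN : u ∉ N) (hvN : v ∉ N)
    (hu : ∀ i, i ≠ u → G.Adj u i) (hv : ∀ i, i ≠ u → (G.Adj v i ↔ i ∈ N)) (x : W → ℝ) :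
    (adjR G *ᵥ x) v = x u + ∑ i ∈ N, x i := by
  classical
  simp only [mulVec, dotProduct]
  rw [sum_eq_add_add_sum_add_sum huv huN hvN, adjR_of_not_adj G (G.loopless.irrefl v),
    adjR_of_adj G (hu v huv.symm).symm, zero_mul, one_mul, add_zero]
  have h1 : ∑ i ∈ N, adjR G v i * x i = ∑ i ∈ N, x i := by
    refine Finset.sum_congr rfl fun i hi => ?_
    rw [adjR_of_adj G ((hv i fun h => huN (h ▸ hi)).mpr hi), one_mul]
  have h2 : ∑ i ∈ Finset.univ \ insert u (insert v N), adjR G v i * x i = 0 := by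
    refine Finset.sum_eq_zero fun i hi => ?_
    simp only [Finset.mem_sdiff, Finset.mem_univ, true_and, Finset.mem_insert, not_or] at hi
    rw [adjR_of_not_adj G (mt (hv i hi.1).mp hi.2.2), zero_mul]
  rw [h1, h2, add_zero]

theorem adjR_mulVec_mem (huv : u ≠ v) (huN : u ∉ N) (hvN : v ∉ N)
    (hu : ∀ i, i ≠ u → G.Adj u i) (hv : ∀ i, i ≠ u → (G.Adj v i ↔ i ∈ N))
    (hN : ∀ i j, i ≠ u → j ≠ u → i ≠ v → j ≠ v → G.Adj i j → j ∈ N) (x : W → ℝ) {i : W}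
    (hi : i ∈ N) : (adjR G *ᵥ x) i = x u + x v + ∑ j ∈ N, adjR G i j * x j := by
  classical
  have hiu : i ≠ u := fun h => huN (h ▸ hi)
  have hiv : i ≠ v := fun h => hvN (h ▸ hi)
  simp only [mulVec, dotProduct]
  rw [sum_eq_add_add_sum_add_sum huv huN hvN, adjR_of_adj G (hu i hiu).symm,
    adjR_of_adj G ((hv i hiu).mpr hi).symm, one_mul, one_mul]
  have h2 : ∑ j ∈ Finset.univ \ insert u (insert v N), adjR G i j * x j = 0 := by
    refine Finset.sum_eq_zero fun j hj => ?_
    simp only [Finset.mem_sdiff, Finset.mem_univ, true_and, Finset.mem_insert, not_or] at hj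
    rw [adjR_of_not_adj G (mt (hN i j hiu hj.1 hiv hj.2.1) hj.2.2), zero_mul]
  rw [h2, add_zero]

theorem adjR_mulVec_of_notMem (huv : u ≠ v) (huN : u ∉ N) (hvN : v ∉ N)
    (hu : ∀ i, i ≠ u → G.Adj u i) (hv : ∀ i, i ≠ u → (G.Adj v i ↔ i ∈ N))
    (hN : ∀ i j, i ≠ u → j ≠ u → i ≠ v → j ≠ v → G.Adj i j → j ∈ N) (x : W → ℝ) {i : W}
    (hiu : i ≠ u) (hiv : i ≠ v) (hi : i ∉ N) : (adjR G *ᵥ x) i = x u := by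
  classical
  simp only [mulVec, dotProduct]
  rw [sum_eq_add_add_sum_add_sum huv huN hvN, adjR_of_adj G (hu i hiu).symm,
    adjR_of_not_adj G (fun h => hi ((hv i hiu).mp h.symm)), one_mul, zero_mul, add_zero,
    Finset.sum_eq_zero, Finset.sum_eq_zero, add_zero, add_zero]
  · intro j hj
    simp only [Finset.mem_sdiff, Finset.mem_univ, true_and, Finset.mem_insert, not_or] at hj
    rw [adjR_of_not_adj G (mt (hN i j hiu hj.1 hiv hj.2.1) hj.2.2), zero_mul]
  · intro j hj
    have hju : j ≠ u := fun h => huN (h ▸ hj)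
    have hjv : j ≠ v := fun h => hvN (h ▸ hj)
    rw [adjR_of_not_adj G (fun h => hi (hN j i hju hiu hjv hiv h.symm)), zero_mul]

end DominatingPair

/-- Here y = x_u, z = x_v, and (y + z)S is the total entry on N. The row of v gives (y + z)(l - S) =
(l + 1)y, which eliminates z from the row of u; y then cancels. -/
theorem eq_coneWeight {N d l S y z : ℝ} (hl : 0 < l) (hy : 0 < y) (hz : 0 < z)
    (h1 : l * z = y + (y + z) * S) (h2 : l * y = z + (y + z) * S + (N - d) * (y / l)) :
    l * S < l ^ 2 ∧ l = coneWeight N d (l * S) l := by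
  have h3 : (y + z) * (l - S) = (l + 1) * y := by linear_combination h1
  have hS : 0 < l - S := by
    refine pos_of_mul_pos_right (a := y + z) ?_ (by linarith)
    rw [h3]
    positivity
  refine ⟨by nlinarith, ?_⟩
  have h4 : l ^ 2 - l * S = l * (l - S) := by ring
  have h5 : y + z = (l + 1) * y / (l - S) := by rw [eq_div_iff hS.ne', h3]
  have h6 : z = (l + 1) * y / (l - S) - y := by linarith
  rw [h5, h6] at h2
  unfold coneWeight
  rw [h4]
  field_simp at h2 ⊢
  linarith

/-! ### The extremal graph -/

section Main
variable {W : Type*} [Fintype W] {G : SimpleGraph W} {n e : ℕ}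

theorem AttainsMaxSpectralRadius.nonempty_iso_graphV (hG : AttainsMaxSpectralRadius n e G)
    (he : 5 ≤ e) (ht : 1 ≤ excessParam e)
    (hn : (n : ℝ) > (e : ℝ) + 2 +
      ellParam e * (ellParam e + 1) * (ellParam e ^ 2 - ellParam e - 2 * (e : ℝ)) /
        (ellParam e ^ 2 - (e : ℝ))) : Nonempty (G ≃g graphV n e) := by
  classical
  obtain ⟨hn2, hcone⟩ := ellParam_lt_coneWeight he ht hn
  have hen : e + 2 ≤ n := by exact_mod_cast hn2.le
  obtain ⟨hl0, hel, -⟩ := ellParam_bounds he ht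
  have hcard : Fintype.card W = n := hG.1.2.1
  have hne : Nonempty W := hG.1.1.nonempty
  obtain ⟨l, hl, hρ, -, x, hx0, hxne, hAx⟩ := exists_perron G
  have hx := perron_pos G hG.1.1 hx0 hxne hAx
  have hle := hG.le (inClassC_graphV hen)
  rw [hρ] at hle
  have hellt : ellParam e < l := (ENNReal.ofReal_lt_ofReal_iff_of_nonneg hl0.le).mp
    ((lt_graphSpectralRadius_graphV hen hl0 hel hcone).trans_le hle)
  have hlpos : 0 < l := hl0.trans hellt
  obtain ⟨u, v, N, huv, huN, hvN, hu, hv, hN⟩ :=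
    hG.exists_dominating_pair (by omega) hl hρ hx hAx
  have hRcard : ((Finset.univ \ insert u (insert v N)).card : ℝ) = n - 2 - N.card := by
    rw [Finset.card_sdiff_of_subset (Finset.subset_univ _), Nat.cast_sub
      (Finset.card_le_card (Finset.subset_univ _)), Finset.card_univ, hcard,
      Finset.card_insert_of_notMem (by simp [huv, huN]), Finset.card_insert_of_notMem hvN]
    push_cast
    ring
  have hR : ∀ i ∈ Finset.univ \ insert u (insert v N), i ≠ u ∧ i ≠ v ∧ i ∉ N := by
    intro i hi
    simpa using hi
  -- Edges are counted by applying the row formulas to the all-ones vector.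
  have hedges : ∑ i ∈ N, ∑ j ∈ N, adjR G i j = 2 * ((e : ℝ) - N.card) := by
    have h1 := sum_adjR G
    have h2 : ∀ i, ∑ j, adjR G i j = (adjR G *ᵥ fun _ => 1) i := by
      intro i
      simp [mulVec, dotProduct]
    have h3 : (G.edgeSet.ncard : ℝ) + 1 = n + e := by exact_mod_cast hG.1.2.2
    simp only [h2] at h1
    rw [sum_eq_add_add_sum_add_sum huv huN hvN, adjR_mulVec_dominating huv huN hvN hu,
      adjR_mulVec_second huv huN hvN hu hv,
      Finset.sum_congr rfl fun i hi => adjR_mulVec_mem huv huN hvN hu hv hN _ hi,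
      Finset.sum_congr rfl fun i hi => adjR_mulVec_of_notMem huv huN hvN hu hv hN _
        (hR i hi).1 (hR i hi).2.1 (hR i hi).2.2] at h1
    simp only [Finset.sum_const, nsmul_eq_mul, mul_one, Finset.sum_add_distrib, hRcard] at h1
    linarith
  have hdle : N.card ≤ e := by
    have h1 : 0 ≤ ∑ i ∈ N, ∑ j ∈ N, adjR G i j :=
      Finset.sum_nonneg fun i _ => Finset.sum_nonneg fun j _ => adjR_nonneg G i j
    have h2 : (N.card : ℝ) ≤ e := by linarith
    exact_mod_cast h2
  rcases eq_or_lt_of_le hdle with hd | hd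
  · refine _root_.nonempty_iso_graphV G hen hcard hd huv huN hvN hu hv
      fun i j hi hj hiv hjv hij => ?_
    have hiN := hN j i hj hi hjv hiv hij.symm
    have hjN := hN i j hi hj hiv hjv hij
    rw [hd, sub_self, mul_zero, Finset.sum_eq_zero_iff_of_nonneg
      fun i _ => Finset.sum_nonneg fun j _ => adjR_nonneg G i j] at hedges
    have h1 := hedges i hiN
    rw [Finset.sum_eq_zero_iff_of_nonneg fun j _ => adjR_nonneg G i j] at h1
    have h2 := h1 j hjN
    rw [adjR_of_adj G hij] at h2
    exact one_ne_zero h2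
  · exfalso
    have he1 : (1 : ℝ) ≤ e - N.card := by
      have : ((N.card + 1 : ℕ) : ℝ) ≤ e := by exact_mod_cast hd
      push_cast at this
      linarith
    have h01 : ∀ i j, adjR G i j = 0 ∨ adjR G i j = 1 := fun i j => by
      by_cases h : G.Adj i j
      · exact Or.inr (adjR_of_adj G h)
      · exact Or.inl (adjR_of_not_adj G h)
    have hdiag : ∀ i, adjR G i i = 0 := fun i => adjR_of_not_adj G (G.loopless.irrefl i)
    obtain ⟨K, hK, hKe⟩ := exists_triangularRoot he1
    obtain ⟨q, hq, hqe⟩ := exists_triangularRoot (m := e)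
      (by linarith [show (0 : ℝ) ≤ N.card from Nat.cast_nonneg _])
    obtain ⟨hq2, hqell⟩ := sq_lt_ellParam_mul he ht hq hqe
    have hL : q ^ 2 < l * (q - 2) :=
      hqell.trans (mul_lt_mul_of_pos_right hellt (sub_pos.mpr hq2))
    have hKd : K + 1 ≤ N.card := by
      have h1 := sum_sum_le_card_mul N (adjR G)
        (fun i j => by rcases h01 i j with h | h <;> rw [h]; norm_num) hdiag
      rw [hedges, ← hKe] at h1
      have h2 : (0 : ℝ) ≤ N.card := Nat.cast_nonneg _
      by_contra! h3
      nlinarith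
    -- Indeed q(q + 1) = K(K + 1) + 2d ≥ (K + 1)(K + 2), by `hKd`.
    have hKq : K + 1 ≤ q := by
      by_contra! h3
      nlinarith
    have hyz : 0 < x u + x v := add_pos (hx u) (hx v)
    have hlx : ∀ i, l * x i = (adjR G *ᵥ x) i := fun i => by rw [hAx]; rfl
    set S := ∑ i ∈ N, x i / (x u + x v) with hS
    set T := ∑ i ∈ N, (∑ j ∈ N, adjR G i j) * (x i / (x u + x v)) with hT
    have hz : ∀ i ∈ N, l * (x i / (x u + x v)) =
        1 + ∑ j ∈ N, adjR G i j * (x j / (x u + x v)) := by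
      intro i hi
      rw [← mul_div_assoc, hlx, adjR_mulVec_mem huv huN hvN hu hv hN x hi, add_div,
        div_self hyz.ne', Finset.sum_div]
      simp only [mul_div_assoc]
    have hTle := degree_weighted_sum_le N (adjR G) h01 (adjR_comm G) hdiag hedges hK hKe hlpos
      (fun i _ => (div_pos (hx i) hyz).le) hz
    have hST : l * S = N.card + T := by
      rw [hS, Finset.mul_sum, Finset.sum_congr rfl hz, Finset.sum_add_distrib, hT,
        Finset.sum_comm]
      simp only [Finset.sum_mul, Finset.sum_const, nsmul_eq_mul, mul_one]
      congr 1
      refine Finset.sum_congr rfl fun i _ => Finset.sum_congr rfl fun j _ => ?_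
      rw [adjR_comm]
    have hSx : (x u + x v) * S = ∑ i ∈ N, x i := by
      rw [hS, ← Finset.sum_div, mul_div_cancel₀ _ hyz.ne']
    have hxR : ∀ i ∈ Finset.univ \ insert u (insert v N), x i = x u / l := by
      intro i hi
      rw [eq_div_iff hlpos.ne', mul_comm, hlx, adjR_mulVec_of_notMem huv huN hvN hu hv hN _
        (hR i hi).1 (hR i hi).2.1 (hR i hi).2.2]
    obtain ⟨hlt, heq⟩ := eq_coneWeight (N := (n : ℝ) - 2) (d := N.card) hlpos (hx u) (hx v)
      (by rw [hlx, adjR_mulVec_second huv huN hvN hu hv, hSx])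
      (by
        rw [hlx, adjR_mulVec_dominating huv huN hvN hu, hSx, Finset.sum_congr rfl hxR,
          Finset.sum_const, nsmul_eq_mul, hRcard])
    rw [hST] at hlt heq
    have hlt2 := coneWeight_lt (N := (n : ℝ) - 2) (e := e) (Nat.cast_nonneg N.card)
      (by ring) hK hKe hq2 hqe hKq hL hlt hTle
    rw [← heq] at hlt2
    have hel2 : (e : ℝ) < l ^ 2 := hel.trans (by gcongr)
    exact absurd (lt_graphSpectralRadius_graphV hen hlpos hel2 hlt2) (not_lt.mpr hle)

end Main

theorem mainTheorem2 (e n : ℕ) (he : 5 ≤ e) (ht : 1 ≤ excessParam e)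
    (hn : (n : ℝ) > (e : ℝ) + 2 +
      ellParam e * (ellParam e + 1) * (ellParam e ^ 2 - ellParam e - 2 * (e : ℝ)) /
        (ellParam e ^ 2 - (e : ℝ))) :
    AttainsMaxSpectralRadius n e (graphV n e) ∧
      ∀ {W : Type*} [Fintype W] (G : SimpleGraph W),
        AttainsMaxSpectralRadius n e G → Nonempty (G ≃g graphV n e) := by
  refine ⟨?_, fun G hG => hG.nonempty_iso_graphV he ht hn⟩
  have hen : e + 2 ≤ n := by exact_mod_cast (ellParam_lt_coneWeight he ht hn).1.le
  have hV := inClassC_graphV hen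
  let φ := Fintype.equivFinOfCardEq hV.2.1
  have hφ : InClassC n e ((graphV n e).map φ.toEmbedding) :=
    hV.of_iso (SimpleGraph.Iso.map φ (graphV n e))
  -- A maximiser exists by finiteness, and uniqueness identifies it with `graphV n e`, which
  -- therefore attains the maximum.
  obtain ⟨H, hH, hmax⟩ := Set.exists_max_image {H : SimpleGraph (Fin n) | InClassC n e H}
    (fun H => graphSpectralRadius H) (Set.toFinite _) ⟨_, hφ⟩
  obtain ⟨f⟩ := AttainsMaxSpectralRadius.nonempty_iso_graphV (G := H) ⟨hH, hmax⟩ he ht hn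
  refine ⟨hV, fun H' hH' => ?_⟩
  rw [← graphSpectralRadius_congr f]
  exact hmax H' hH'
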